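/- Let $d\ge 0$ and $k\ge 4$ be integers and let $a_1,\dots,a_k$ be positive integers with $a_1+\dots+a_k=\binom{d+2}{2}$. The $k$-chain $C_{a_1,\dots,a_k}$ is the graph whose vertex set is a disjoint union $A_1\cup\dots\cup A_k$ with $|A_i|=a_i$, in which every vertex of $A_i$ is adjacent to every vertex of $A_{i+1}$ for $1\le i\le k-1$, and there are no other edges. Suppose that $G=C_{a_1,\dots,a_k}$ is (vertex) $(d+1)$-connected, that is, it has more than $d+1$ vertices and removing any set of at most $d$ vertices leaves a connected graph. Then $G$ is generically locally rigid in $\mathbb{R}^d$, in the following sense. Let $p$ assign to each vertex $v$ of $G$ a point $p_v\in\mathbb{R}^d$ so that the coordinates of all these points are algebraically independent over $\mathbb{Q}$. Let $\gamma(t)$, $t\in[0,1]$, be a differentiable family of assignments of points of $\mathbb{R}^d$ to the vertices (not required to be generic for $t>0$) with $\gamma(0)=p$ and $|\gamma_u(t)-\gamma_v(t)|=|p_u-p_v|$ for all edges $\{u,v\}$ of $G$ and all $t\in[0,1]$. Then for every $t\in[0,1]$ there is an isometry $g$ of $\mathbb{R}^d$ with $\gamma_v(t)=g(p_v)$ for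 all vertices $v$ of $G$. -/

import Mathlib

/-- The vertex set of the chain `C_{a_1, ..., a_k}`: the disjoint union of sets `A_i` with
`|A_i| = a i`, indexed by `i : Fin k` (so from `0`). -/
abbrev ChainVertex {k : ℕ} (a : Fin k → ℕ) : Type :=
  (i : Fin k) × Fin (a i)

/-- The `k`-chain `C_{a_1, ..., a_k}`: every vertex of `A_i` is joined to every vertex of `A_{i+1}`,
and there are no other edges. -/
def chainGraph {k : ℕ} (a : Fin k → ℕ) : SimpleGraph (ChainVertex a) where
  Adj x y := (x.1 : ℕ) + 1 = (y.1 : ℕ) ∨ (y.1 : ℕ) + 1 = (x.1 : ℕ)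
  symm := ⟨fun _ _ h => h.symm⟩
  loopless := ⟨fun x h => by rcases h with h | h <;> omega⟩

/-- A finite graph is (vertex) `n`-connected if it has more than `n` vertices and stays connected
after the removal of any set of fewer than `n` vertices. -/
def IsVertexConnected {V : Type*} [Fintype V] (n : ℕ) (G : SimpleGraph V) : Prop :=
  n < Fintype.card V ∧
    ∀ S : Finset V, S.card < n → (G.induce ((S : Set V)ᶜ)).Connected

/-- A realization of the vertex set `V` in `ℝ^d`: a position for every vertex. -/
abbrev Realization (V : Type*) (d : ℕ) : Type _ :=
  V → EuclideanSpace ℝ (Fin d)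

/-- A realization is generic if its coordinates are algebraically independent over `ℚ`. -/
def IsGenericRealization {V : Type*} {d : ℕ} (p : Realization V d) : Prop :=
  AlgebraicIndependent ℚ (fun c : V × Fin d => p c.1 c.2)

/-- Half the squared distance between the two ends of an unordered pair of vertices. -/
noncomputable def halfSqLength {V : Type*} {d : ℕ} (p : Realization V d) : Sym2 V → ℝ :=
  Sym2.lift ⟨fun u v => (1 / 2 : ℝ) * ‖p u - p v‖ ^ 2, fun u v => by simp only [norm_sub_rev]⟩

/-- The half edge-length squared function `f_G : ℝ^{vd} → ℝ^e`. -/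
noncomputable def edgeLengthMap {V : Type*} {d : ℕ} (G : SimpleGraph V) (p : Realization V d) :
    G.edgeSet → ℝ :=
  fun e => halfSqLength p e

/-- A flexing of the framework `G(p)`: a differentiable one-parameter family of realizations,
parametrized by `[0, 1]` and starting at `p`, along which `f_G` keeps the value `f_G(p)`. -/
def IsFlexing {V : Type*} [Fintype V] {d : ℕ} (G : SimpleGraph V) (p : Realization V d)
    (γ : ℝ → Realization V d) : Prop :=
  DifferentiableOn ℝ γ (Set.Icc 0 1) ∧ γ 0 = p ∧
    ∀ t ∈ Set.Icc (0 : ℝ) 1, edgeLengthMap G (γ t) = edgeLengthMap G p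

/-- Two realizations are congruent if a Euclidean motion (an isometry of `ℝ^d`) takes one to the
other. -/
def IsCongruent {V : Type*} {d : ℕ} (p q : Realization V d) : Prop :=
  ∃ g : EuclideanSpace ℝ (Fin d) ≃ᵢ EuclideanSpace ℝ (Fin d), ∀ v, q v = g (p v)

/-- The framework `G(p)` is locally rigid if each of its flexings is trivial, that is, moves `p` by
Euclidean motions only. -/
def IsLocallyRigid {V : Type*} [Fintype V] {d : ℕ} (G : SimpleGraph V)
    (p : Realization V d) : Prop :=
  ∀ γ : ℝ → Realization V d, IsFlexing G p γ → ∀ t ∈ Set.Icc (0 : ℝ) 1, IsCongruent p (γ t)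

/-- A graph is generically locally rigid in `ℝ^d` if all of its generic frameworks in `ℝ^d` are
locally rigid. -/
def IsGenericallyLocallyRigid {V : Type*} [Fintype V] (d : ℕ) (G : SimpleGraph V) : Prop :=
  ∀ p : Realization V d, IsGenericRealization p → IsLocallyRigid G p

/-!
The proof shows that a generic chain framework, and every framework close to it, is
infinitesimally rigid; `isLocallyRigid_of_eventually` then turns this into local rigidity by
integrating along a flexing.

Give a point `q` the homogeneous coordinates `P = (1, q)` and lift a velocity `x` at `q` to
`X = (-⟪q, x⟫, x)`. Then `X u ⬝ P v + X v ⬝ P u = -⟪q u - q v, x u - x v⟫`, so an infinitesimal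
flex satisfies `X u ⬝ P v + X v ⬝ P u = 0` on every edge `uv`, and the definition of the lift
gives `X v ⬝ P v = 0` at every vertex. Connectivity makes every inner part of the chain have at
least `d + 1` vertices (`IsVertexConnected.lt_of_chainGraph`), whose homogeneous coordinates span
the space. As `k ≥ 4`, two inner parts are adjacent, and the edge equations between them force
`X v = M (P v)` on one and `X v = -Mᵀ (P v)` on the other for a single matrix `M`; this form
propagates, alternating, through the whole chain. The equations `X v ⬝ P v = 0` now say that the
quadric of `M` contains all the points. There are `(d + 2).choose 2` of them, the dimension of the
space of quadrics, and no quadric contains them, so `M` is skew-symmetric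
(`transpose_eq_neg_of_det_quadCoord_ne_zero`). Then `X v = M (P v)` everywhere and the flex is
trivial (`isInfinitesimallyRigid_chainGraph`).

The spanning and quadric conditions are the nonvanishing of determinants of distinct monomials. They
are open conditions on the realization, and they hold at generic ones by
`IsGenericRealization.det_monomial_ne_zero`.
-/

open scoped RealInnerProductSpace Topology

/-! ### Congruent families of points -/

/-- Two finite families of vectors with the same Gram matrix differ by a linear isometry. -/
theorem exists_linearIsometryEquiv_of_inner_eq {V E : Type*} [Finite V] [NormedAddCommGroup E]
    [InnerProductSpace ℝ E] [FiniteDimensional ℝ E] {x y : V → E}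
    (h : ∀ v w, ⟪x v, x w⟫ = ⟪y v, y w⟫) : ∃ L : E ≃ₗᵢ[ℝ] E, ∀ v, L (x v) = y v := by
  classical
  cases nonempty_fintype V
  let T := Fintype.linearCombination ℝ x
  let T' := Fintype.linearCombination ℝ y
  have hnorm : ∀ c, ‖T' c‖ = ‖T c‖ := by
    intro c
    have : ⟪T' c, T' c⟫ = ⟪T c, T c⟫ := by
      simp only [T, T', Fintype.linearCombination_apply, sum_inner, inner_sum, inner_smul_left,
        inner_smul_right, h]
    rw [real_inner_self_eq_norm_sq, real_inner_self_eq_norm_sq] at this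
    exact (sq_eq_sq₀ (norm_nonneg _) (norm_nonneg _)).1 this
  obtain ⟨s, hs⟩ := T.rangeRestrict.exists_rightInverse_of_surjective T.range_rangeRestrict
  have hs' : ∀ z : LinearMap.range T, T (s z) = z := fun z =>
    congrArg Subtype.val (LinearMap.congr_fun hs z)
  let L₀ : LinearMap.range T →ₗᵢ[ℝ] E :=
    { toLinearMap := T' ∘ₗ s
      norm_map' := fun z => by
        rw [LinearMap.comp_apply, hnorm, hs']
        rfl }
  refine ⟨L₀.extend.toLinearIsometryEquiv rfl, fun v => ?_⟩
  have hx : T (Pi.single v 1) = x v := by simp [T]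
  have hy : T' (Pi.single v 1) = y v := by simp [T']
  let z : LinearMap.range T := ⟨x v, Pi.single v 1, hx⟩
  have h0 : T' (s z - Pi.single v 1) = 0 := by
    rw [← norm_eq_zero, hnorm, map_sub, hs', hx]
    simp [z]
  have h1 : L₀ z = y v := by
    rw [map_sub, sub_eq_zero, hy] at h0
    exact h0
  rw [← h1, LinearIsometry.coe_toLinearIsometryEquiv]
  exact L₀.extend_apply z

theorem isCongruent_of_norm_sub_eq {V : Type*} [Finite V] {d : ℕ} {p q : Realization V d}
    (h : ∀ u v, ‖q u - q v‖ = ‖p u - p v‖) : IsCongruent p q := by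
  rcases isEmpty_or_nonempty V with hV | ⟨⟨o⟩⟩
  · exact ⟨IsometryEquiv.refl _, fun v => isEmptyElim v⟩
  obtain ⟨L, hL⟩ := exists_linearIsometryEquiv_of_inner_eq
    (x := fun v => p v - p o) (y := fun v => q v - q o) (fun v w => by
      simp only [real_inner_eq_norm_mul_self_add_norm_mul_self_sub_norm_sub_mul_self_div_two,
        sub_sub_sub_cancel_right, h])
  refine ⟨((IsometryEquiv.subRight (p o)).trans L.toIsometryEquiv).trans
    (IsometryEquiv.addRight (q o)), fun v => ?_⟩
  simp [hL]

/-! ### Infinitesimal rigidity and flexings -/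

/-- The framework `G(q)` is infinitesimally rigid if every velocity field that preserves the
lengths of the edges to first order preserves all pairwise distances to first order. -/
def IsInfinitesimallyRigid {V : Type*} {d : ℕ} (G : SimpleGraph V) (q : Realization V d) : Prop :=
  ∀ x : Realization V d, (∀ u v, G.Adj u v → ⟪q u - q v, x u - x v⟫ = 0) →
    ∀ u v, ⟪q u - q v, x u - x v⟫ = 0

theorem IsInfinitesimallyRigid.of_comp_isometryEquiv {V : Type*} {d : ℕ} {G : SimpleGraph V}
    {q : Realization V d} (g : EuclideanSpace ℝ (Fin d) ≃ᵢ EuclideanSpace ℝ (Fin d))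
    (h : IsInfinitesimallyRigid G fun v => g (q v)) : IsInfinitesimallyRigid G q := by
  let L := g.toRealAffineIsometryEquiv.linearIsometryEquiv
  have hL : ∀ (x : Realization V d) u v,
      ⟪g (q u) - g (q v), L (x u) - L (x v)⟫ = ⟪q u - q v, x u - x v⟫ := by
    intro x u v
    have : g (q u) - g (q v) = L (q u - q v) :=
      (g.toRealAffineIsometryEquiv.map_vsub (q u) (q v)).symm
    rw [this, ← map_sub, L.inner_map_map]
  intro x hx u v
  rw [← hL]
  exact h (fun v => L (x v)) (fun u v huv => (hL x u v).trans (hx u v huv)) u v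

theorem IsFlexing.norm_sub_eq {V : Type*} [Fintype V] {d : ℕ} {G : SimpleGraph V}
    {p : Realization V d} {γ : ℝ → Realization V d} (h : IsFlexing G p γ) {t : ℝ}
    (ht : t ∈ Set.Icc (0 : ℝ) 1) {u v : V} (huv : G.Adj u v) :
    ‖γ t u - γ t v‖ ^ 2 = ‖p u - p v‖ ^ 2 := by
  have := congrFun (h.2.2 t ht) ⟨s(u, v), huv⟩
  simpa [edgeLengthMap, halfSqLength] using this

/-- A framework all of whose small perturbations are infinitesimally rigid is locally rigid. The
set of times at which a flexing is congruent to `p` is closed; just after such a time the flexing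
is infinitesimally rigid, so its velocity does not change any distance. -/
theorem isLocallyRigid_of_eventually {V : Type*} [Fintype V] {d : ℕ} {G : SimpleGraph V}
    {p : Realization V d} (hp : ∀ᶠ q in 𝓝 p, IsInfinitesimallyRigid G q) :
    IsLocallyRigid G p := by
  intro γ hγ
  have hcont : ContinuousOn γ (Set.Icc 0 1) := hγ.1.continuousOn
  let T : Set ℝ := {t | ∀ u v, ‖γ t u - γ t v‖ = ‖p u - p v‖}
  suffices hT : Set.Icc (0 : ℝ) 1 ⊆ T from fun t ht => isCongruent_of_norm_sub_eq (hT ht)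
  have hderiv : ∀ t ∈ Set.Icc (0 : ℝ) 1, ∀ u v, HasDerivWithinAt (fun t => ‖γ t u - γ t v‖ ^ 2)
      (2 * ⟪γ t u - γ t v, derivWithin γ (Set.Icc 0 1) t u - derivWithin γ (Set.Icc 0 1) t v⟫)
      (Set.Icc 0 1) t := by
    intro t ht u v
    have h := (hγ.1 t ht).hasDerivWithinAt
    rw [hasDerivWithinAt_pi] at h
    exact ((h u).sub (h v)).norm_sq
  refine IsClosed.Icc_subset_of_forall_mem_nhdsWithin ?_ (fun u v => by rw [hγ.2.1]) ?_
  · have hclosed : IsClosed {q : Realization V d | ∀ u v, ‖q u - q v‖ = ‖p u - p v‖} := by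
      simp only [Set.ofPred_forall]
      exact isClosed_iInter fun u => isClosed_iInter fun v =>
        isClosed_eq (by fun_prop) continuous_const
    rw [Set.inter_comm]
    exact hcont.preimage_isClosed_of_isClosed isClosed_Icc hclosed
  · rintro t₀ ⟨ht₀, h0, h1⟩
    obtain ⟨g, hg⟩ := isCongruent_of_norm_sub_eq ht₀
    have hev : ∀ᶠ t in 𝓝[≥] t₀, t ∈ Set.Icc (0 : ℝ) 1 ∧ IsInfinitesimallyRigid G (γ t) := by
      have hmem : Set.Icc (0 : ℝ) 1 ∈ 𝓝[≥] t₀ := Icc_mem_nhdsGE_of_mem ⟨h0, h1⟩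
      refine Filter.Eventually.and hmem ?_
      have hc : Filter.Tendsto (fun t v => g.symm (γ t v)) (𝓝[≥] t₀) (𝓝 p) := by
        have h2 : Filter.Tendsto γ (𝓝[≥] t₀) (𝓝 (γ t₀)) :=
          (hcont t₀ ⟨h0, h1.le⟩).mono_left (nhdsWithin_le_iff.2 hmem)
        rw [tendsto_pi_nhds] at h2 ⊢
        intro v
        have h3 := (g.symm.continuous.tendsto (γ t₀ v)).comp (h2 v)
        rwa [hg, g.symm_apply_apply] at h3
      exact (hc.eventually hp).mono fun t ht => ht.of_comp_isometryEquiv g.symm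
    obtain ⟨b, hb, hsub⟩ := mem_nhdsGE_iff_exists_Icc_subset.1 hev
    refine Filter.mem_of_superset (Ioc_mem_nhdsGT hb) fun t ht u v => ?_
    have hsub' : Set.Icc t₀ b ⊆ Set.Icc 0 1 := fun s hs => (hsub hs).1
    have hzero : ∀ s ∈ Set.Icc t₀ b,
        HasDerivWithinAt (fun t => ‖γ t u - γ t v‖ ^ 2) 0 (Set.Icc t₀ b) s := by
      intro s hs
      have hrig := (hsub hs).2 (derivWithin γ (Set.Icc 0 1) s) (fun u v huv => by
        have hd := hderiv s (hsub' hs) u v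
        have hd0 : HasDerivWithinAt (fun t => ‖γ t u - γ t v‖ ^ 2) 0 (Set.Icc 0 1) s :=
          (hasDerivWithinAt_const s _ (‖p u - p v‖ ^ 2)).congr_of_mem
            (fun r hr => hγ.norm_sub_eq hr huv) (hsub' hs)
        have := (uniqueDiffOn_Icc zero_lt_one s (hsub' hs)).eq_deriv _ hd hd0
        linarith) u v
      have hd := (hderiv s (hsub' hs) u v).mono hsub'
      rwa [hrig, mul_zero] at hd
    have hconst := constant_of_derivWithin_zero
      (fun s hs => (hzero s hs).differentiableWithinAt)
      (fun s hs => (hzero s (Set.Ico_subset_Icc_self hs)).derivWithin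
        (uniqueDiffOn_Icc hb s (Set.Ico_subset_Icc_self hs))) t (Set.Ioc_subset_Icc_self ht)
    rw [← ht₀ u v]
    exact (sq_eq_sq₀ (norm_nonneg _) (norm_nonneg _)).1 hconst

/-! ### Determinants of monomials at generic points -/

/-- Evaluating distinct monomials at as many points with independent coordinates gives a nonzero
determinant: the terms of the Leibniz expansion are pairwise distinct monomials in the coordinates
of all the points, so they cannot cancel. -/
theorem IsGenericRealization.det_monomial_ne_zero {V ι : Type*} [Fintype ι] [DecidableEq ι] {d : ℕ}
    {p : Realization V d} (hp : IsGenericRealization p) (e : ι ↪ V) (m : ι → Fin d →₀ ℕ)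
    (hm : Function.Injective m) :
    (Matrix.of fun i j => (m j).prod fun c n => p (e i) c ^ n).det ≠ 0 := by
  classical
  let emb : ι → Fin d ↪ V × Fin d := fun i => ⟨fun c => (e i, c), fun _ _ h => (Prod.ext_iff.1 h).2⟩
  let A : Matrix ι ι (MvPolynomial (V × Fin d) ℚ) :=
    Matrix.of fun i j => MvPolynomial.monomial ((m j).embDomain (emb i)) 1
  let D : Equiv.Perm ι → V × Fin d →₀ ℕ := fun σ => ∑ i, (m i).embDomain (emb (σ i))
  have hDapp : ∀ σ l c, D σ (e l, c) = m (σ.symm l) c := by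
    intro σ l c
    simp only [D, Finsupp.finsetSum_apply]
    rw [Finset.sum_eq_single (σ.symm l)]
    · rw [Equiv.apply_symm_apply]
      exact Finsupp.embDomain_apply_self (emb l) _ c
    · intro i _ hi
      refine Finsupp.embDomain_of_notMem_range _ _ _ ?_
      rintro ⟨c', hc'⟩
      have : σ i = l := e.injective (Prod.ext_iff.1 hc').1
      exact hi (by simp [← this])
    · simp
  have hD : ∀ σ, D σ = D 1 → σ = 1 := by
    intro σ hσ
    have h1 : σ.symm = 1 := by
      ext1 l
      refine hm (Finsupp.ext fun c => ?_)
      rw [← hDapp, hσ, hDapp]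
      rfl
    exact inv_eq_one.1 h1
  have hdet : A.det = ∑ σ : Equiv.Perm ι, MvPolynomial.monomial (D σ) ((σ.sign : ℤ) : ℚ) := by
    rw [Matrix.det_apply']
    refine Finset.sum_congr rfl fun σ _ => ?_
    simp only [A, Matrix.of_apply, ← MvPolynomial.monomial_sum_one, D]
    rw [← map_intCast (MvPolynomial.C (σ := V × Fin d) (R := ℚ)), MvPolynomial.C_mul_monomial,
      mul_one]
  have hA : A.det ≠ 0 := by
    intro h0
    have : MvPolynomial.coeff (D 1) A.det = 1 := by
      rw [hdet, MvPolynomial.coeff_sum, Finset.sum_eq_single 1]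
      · simp
      · intro σ _ hσ
        rw [MvPolynomial.coeff_monomial, if_neg fun h => hσ (hD σ h)]
      · simp
    rw [h0] at this
    simp at this
  have hmap : (Matrix.of fun i j => (m j).prod fun c n => p (e i) c ^ n).det =
      MvPolynomial.aeval (fun c : V × Fin d => p c.1 c.2) A.det := by
    rw [AlgHom.map_det]
    congr 1
    ext i j
    simp [A, MvPolynomial.aeval_monomial, Finsupp.prod_embDomain, emb]
    rfl
  rw [hmap]
  exact fun h => hA ((injective_iff_map_eq_zero _).1 hp _ h)

/-- The homogeneous coordinates `(1, x)` of a point `x`, the entry `1` having index `none`. -/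
def homCoord {d : ℕ} (x : EuclideanSpace ℝ (Fin d)) (o : Option (Fin d)) : ℝ :=
  o.elim 1 x

/-- The exponent of the monomial whose value at `x` is `homCoord x o`. -/
noncomputable def homExponent {d : ℕ} (o : Option (Fin d)) : Fin d →₀ ℕ :=
  o.elim 0 fun c => Finsupp.single c 1

theorem prod_homExponent {d : ℕ} (x : EuclideanSpace ℝ (Fin d)) (o : Option (Fin d)) :
    ((homExponent o).prod fun c n => x c ^ n) = homCoord x o := by
  cases o <;> simp [homExponent, homCoord]

theorem homExponent_apply {d : ℕ} (o : Option (Fin d)) (c : Fin d) :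
    homExponent o c = if o = some c then 1 else 0 := by
  cases o <;> simp [homExponent, Finsupp.single_apply]

/-- The value at `x` of the monomial of degree at most two that is the product of two homogeneous
coordinates. -/
def quadCoord {d : ℕ} (x : EuclideanSpace ℝ (Fin d)) : Sym2 (Option (Fin d)) → ℝ :=
  Sym2.lift ⟨fun a b => homCoord x a * homCoord x b, fun _ _ => mul_comm _ _⟩

/-- The exponent of the monomial whose value at `x` is `quadCoord x s`. -/
noncomputable def quadExponent {d : ℕ} : Sym2 (Option (Fin d)) → Fin d →₀ ℕ :=
  Sym2.lift ⟨fun a b => homExponent a + homExponent b, fun _ _ => add_comm _ _⟩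

theorem prod_quadExponent {d : ℕ} (x : EuclideanSpace ℝ (Fin d)) (s : Sym2 (Option (Fin d))) :
    ((quadExponent s).prod fun c n => x c ^ n) = quadCoord x s := by
  induction s with
  | _ a b =>
    simp only [quadExponent, quadCoord, Sym2.lift_mk]
    rw [Finsupp.prod_add_index' (by simp) (by intros; rw [pow_add]), prod_homExponent,
      prod_homExponent]

theorem homExponent_injective {d : ℕ} : Function.Injective (homExponent (d := d)) := by
  intro a b h
  have h' := fun c => DFunLike.congr_fun h c
  simp only [homExponent_apply] at h'
  rcases a with _ | a <;> rcases b with _ | b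
  · rfl
  · simpa using h' b
  · simpa using h' a
  · have := h' a
    grind

theorem quadExponent_injective {d : ℕ} : Function.Injective (quadExponent (d := d)) := by
  intro s t h
  induction s with
  | _ a b =>
  induction t with
  | _ a' b' =>
    have h' : ∀ c, homExponent a c + homExponent b c = homExponent a' c + homExponent b' c :=
      fun c => DFunLike.congr_fun h c
    simp only [homExponent_apply] at h'
    rw [Sym2.eq_iff]
    rcases a with _ | a <;> rcases b with _ | b <;> rcases a' with _ | a' <;>
      rcases b' with _ | b' <;> grind

theorem continuous_homCoord {d : ℕ} (o : Option (Fin d)) :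
    Continuous fun x : EuclideanSpace ℝ (Fin d) => homCoord x o := by
  cases o with
  | none => exact continuous_const
  | some c => simp only [homCoord, Option.elim]; fun_prop

theorem continuous_quadCoord {d : ℕ} (s : Sym2 (Option (Fin d))) :
    Continuous fun x : EuclideanSpace ℝ (Fin d) => quadCoord x s := by
  induction s with
  | _ a b => exact (continuous_homCoord a).mul (continuous_homCoord b)

/-! ### Infinitesimal rigidity of chains -/

/-- The lift `(-⟪q, x⟫, x)` of a velocity `x` at the point `q`, paired with homogeneous
coordinates. -/
noncomputable def velocityLift {d : ℕ} (q x : EuclideanSpace ℝ (Fin d)) (o : Option (Fin d)) : ℝ :=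
  o.elim (-⟪q, x⟫) x

theorem velocityLift_dotProduct_homCoord {d : ℕ} (q x r : EuclideanSpace ℝ (Fin d)) :
    velocityLift q x ⬝ᵥ homCoord r = ⟪r, x⟫ - ⟪q, x⟫ := by
  simp only [dotProduct, Fintype.sum_option, velocityLift, homCoord, Option.elim, mul_one,
    PiLp.inner_apply, RCLike.inner_apply, conj_trivial]
  ring

theorem velocityLift_add_velocityLift {d : ℕ} (q x r y : EuclideanSpace ℝ (Fin d)) :
    velocityLift q x ⬝ᵥ homCoord r + velocityLift r y ⬝ᵥ homCoord q = -⟪q - r, x - y⟫ := by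
  simp only [velocityLift_dotProduct_homCoord, inner_sub_left, inner_sub_right]
  ring

/-- If the quadratic monomials in the coordinates of the points `q v` have nonzero determinant, so
that no quadric contains all these points, then a matrix whose quadratic form vanishes at all of
them is skew-symmetric. -/
theorem transpose_eq_neg_of_det_quadCoord_ne_zero {V : Type*} {d : ℕ} {q : Realization V d}
    {f : Sym2 (Option (Fin d)) ≃ V} (hf : (Matrix.of fun s => quadCoord (q (f s))).det ≠ 0)
    {M : Matrix (Option (Fin d)) (Option (Fin d)) ℝ}
    (hM : ∀ v, M.mulVec (homCoord (q v)) ⬝ᵥ homCoord (q v) = 0) : M.transpose = -M := by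
  classical
  let c : Sym2 (Option (Fin d)) → ℝ := fun s => ∑ ab : Option (Fin d) × Option (Fin d) with
    s(ab.1, ab.2) = s, M ab.1 ab.2
  have hc : c = 0 := by
    refine Matrix.eq_zero_of_mulVec_eq_zero hf (funext fun t => ?_)
    have h1 := hM (f t)
    simp only [Matrix.mulVec, dotProduct, Finset.sum_mul] at h1
    rw [← Fintype.sum_prod_type'
      (f := fun a b => M a b * homCoord (q (f t)) b * homCoord (q (f t)) a),
      ← Finset.sum_fiberwise _ fun ab : Option (Fin d) × Option (Fin d) => s(ab.1, ab.2)] at h1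
    simp only [Matrix.mulVec, dotProduct, Matrix.of_apply, Pi.zero_apply]
    rw [← h1]
    refine Finset.sum_congr rfl fun s _ => ?_
    rw [Finset.mul_sum]
    refine Finset.sum_congr rfl fun ab hab => ?_
    rw [← (Finset.mem_filter.1 hab).2]
    simp only [quadCoord, Sym2.lift_mk]
    ring
  ext a b
  have hab := congrFun hc s(a, b)
  simp only [c, Pi.zero_apply] at hab
  rw [Matrix.transpose_apply, Matrix.neg_apply]
  by_cases h : a = b
  · subst h
    rw [Finset.sum_eq_single (a, a)] at hab
    · rw [hab, neg_zero]
    · rintro ⟨x, y⟩ hxy hne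
      simp at hxy hne
      exact absurd hxy.2 (hne hxy.1)
    · simp
  · have : (Finset.univ.filter fun ab : Option (Fin d) × Option (Fin d) =>
        s(ab.1, ab.2) = s(a, b)) = {(a, b), (b, a)} := by
      ext ⟨x, y⟩
      simp
    rw [this, Finset.sum_pair (by simpa using fun h' => absurd h' h)] at hab
    linarith

/-- A chain is infinitesimally rigid at `q` if each of its inner parts contains `d + 1` affinely
independent points and no quadric contains all the points `q v`. -/
theorem isInfinitesimallyRigid_chainGraph {d k : ℕ} (hk : 4 ≤ k) {a : Fin k → ℕ}
    {q : Realization (ChainVertex a) d}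
    {e : ∀ i : Fin k, 0 < (i : ℕ) → (i : ℕ) + 1 < k → Option (Fin d) ↪ Fin (a i)}
    (he : ∀ i h0 h1, (Matrix.of fun o => homCoord (q ⟨i, e i h0 h1 o⟩)).det ≠ 0)
    {f : Sym2 (Option (Fin d)) ≃ ChainVertex a}
    (hf : (Matrix.of fun s => quadCoord (q (f s))).det ≠ 0) :
    IsInfinitesimallyRigid (chainGraph a) q := by
  intro x hx
  let P : ChainVertex a → Option (Fin d) → ℝ := fun v => homCoord (q v)
  let X : ChainVertex a → Option (Fin d) → ℝ := fun v => velocityLift (q v) (x v)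
  have hX : ∀ u v, (chainGraph a).Adj u v → X u ⬝ᵥ P v + X v ⬝ᵥ P u = 0 := by
    intro u v huv
    rw [velocityLift_add_velocityLift, hx u v huv, neg_zero]
  have hpair : ∀ (N : Matrix (Option (Fin d)) (Option (Fin d)) ℝ) y z,
      y ⬝ᵥ N.transpose.mulVec z = N.mulVec y ⬝ᵥ z := fun N y z => by
    rw [Matrix.dotProduct_mulVec, Matrix.vecMul_transpose]
  -- If `X v = N (P v)` at `d + 1` spanning points `v` adjacent to `u`, then `X u = -Nᵀ (P u)`.
  have hprop : ∀ (N : Matrix (Option (Fin d)) (Option (Fin d)) ℝ) (u : ChainVertex a)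
      (v : Option (Fin d) → ChainVertex a), (Matrix.of fun o => P (v o)).det ≠ 0 →
      (∀ o, (chainGraph a).Adj u (v o)) → (∀ o, X (v o) = N.mulVec (P (v o))) →
      X u = (-N.transpose).mulVec (P u) := by
    intro N u v hdet hadj hN
    rw [← sub_eq_zero]
    refine Matrix.eq_zero_of_mulVec_eq_zero hdet (funext fun o => ?_)
    have h1 := hX u (v o) (hadj o)
    rw [hN, ← hpair, dotProduct_comm (X u)] at h1
    change P (v o) ⬝ᵥ (X u - (-N.transpose).mulVec (P u)) = 0
    rwa [Matrix.neg_mulVec, sub_neg_eq_add, dotProduct_add]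
  let i₁ : Fin k := ⟨1, by omega⟩
  let i₂ : Fin k := ⟨2, by omega⟩
  -- The matrix `M` is determined by the lifted velocities of `d + 1` points of the part `i₁`.
  obtain ⟨M, hM⟩ : ∃ M : Matrix (Option (Fin d)) (Option (Fin d)) ℝ, ∀ o,
      X ⟨i₁, e i₁ one_pos (by change 1 + 1 < k; omega) o⟩ =
        M.mulVec (P ⟨i₁, e i₁ one_pos (by change 1 + 1 < k; omega) o⟩) := by
    have hB := he i₁ one_pos (by change 1 + 1 < k; omega)
    set B := Matrix.of fun o => homCoord (q ⟨i₁, e i₁ one_pos _ o⟩)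
    let Y := Matrix.of fun o => X ⟨i₁, e i₁ one_pos (by change 1 + 1 < k; omega) o⟩
    refine ⟨(B⁻¹ * Y).transpose, fun o => funext fun b => ?_⟩
    have : (B⁻¹ * Y).transpose * B.transpose = Y.transpose := by
      rw [← Matrix.transpose_mul, Matrix.mul_nonsing_inv_cancel_left _ _ hB.isUnit]
    exact (congrFun (congrFun this b) o).symm
  let σ : ℕ → Matrix (Option (Fin d)) (Option (Fin d)) ℝ := fun j =>
    if Even j then -M.transpose else M
  have hσ : ∀ j, -(σ j).transpose = σ (j + 1) := by
    intro j
    by_cases hj : Even j <;> simp [σ, hj, Nat.even_add_one]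
  have hσ' : ∀ j, -(σ (j + 1)).transpose = σ j := fun j => by
    rw [← hσ]
    simp
  have h₂ : ∀ l, X ⟨i₂, l⟩ = (σ 2).mulVec (P ⟨i₂, l⟩) := fun l =>
    hprop M _ _ (he i₁ one_pos (by change 1 + 1 < k; omega)) (fun o => Or.inr rfl) hM
  have h₁ : ∀ l, X ⟨i₁, l⟩ = (σ 1).mulVec (P ⟨i₁, l⟩) := fun l => by
    rw [← hσ']
    exact hprop _ _ _ (he i₂ two_pos (by change 2 + 1 < k; omega)) (fun o => Or.inl rfl)
      fun o => h₂ _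
  have hpos : ∀ j, 1 ≤ j → ∀ hj : j < k, ∀ l, X ⟨⟨j, hj⟩, l⟩ = (σ j).mulVec (P ⟨⟨j, hj⟩, l⟩) := by
    intro j h1j
    induction j, h1j using Nat.le_induction with
    | base => exact fun _ => h₁
    | succ j h1j ih =>
      intro hj l
      rw [← hσ]
      exact hprop _ _ _ (he ⟨j, by omega⟩ h1j hj) (fun o => Or.inr rfl) fun o => ih _ _
  have hall : ∀ v, X v = (σ v.1).mulVec (P v) := by
    rintro ⟨⟨j, hj⟩, l⟩
    rcases Nat.eq_zero_or_pos j with rfl | hj0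
    · rw [← hσ']
      exact hprop _ _ _ (he i₁ one_pos (by change 1 + 1 < k; omega)) (fun o => Or.inl rfl)
        fun o => h₁ _
    · exact hpos j hj0 hj l
  have hskew : M.transpose = -M := by
    refine transpose_eq_neg_of_det_quadCoord_ne_zero hf fun v => ?_
    have h0 : X v ⬝ᵥ P v = 0 := by
      rw [velocityLift_dotProduct_homCoord, sub_self]
    rw [hall] at h0
    by_cases hv : Even (v.1 : ℕ)
    · simp only [σ, if_pos hv, Matrix.neg_mulVec, neg_dotProduct, neg_eq_zero] at h0
      rwa [dotProduct_comm, hpair] at h0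
    · simpa only [σ, if_neg hv] using h0
  have hallM : ∀ v, X v = M.mulVec (P v) := by
    intro v
    rw [hall]
    simp [σ, hskew]
  intro u v
  rw [← neg_eq_zero, ← velocityLift_add_velocityLift]
  change X u ⬝ᵥ P v + X v ⬝ᵥ P u = 0
  rw [hallM, hallM, ← hpair M (P v), hskew, Matrix.neg_mulVec, dotProduct_neg,
    dotProduct_comm (P v), add_neg_cancel]

/-! ### Connectivity and genericity -/

/-- Removing an inner part disconnects a chain, so inner parts of a `(d + 1)`-connected chain have
at least `d + 1` vertices. -/
theorem IsVertexConnected.lt_of_chainGraph {d k : ℕ} {a : Fin k → ℕ} (ha : ∀ i, 0 < a i)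
    (h : IsVertexConnected (d + 1) (chainGraph a)) {i : Fin k} (h0 : 0 < (i : ℕ))
    (h1 : (i : ℕ) + 1 < k) : d < a i := by
  by_contra! hle
  let S : Finset (ChainVertex a) := Finset.univ.map (Function.Embedding.sigmaMk i)
  have hS : ∀ v, v ∈ S ↔ v.1 = i := by
    rintro ⟨j, l⟩
    constructor
    · intro hv
      obtain ⟨l', -, hl'⟩ := Finset.mem_map.1 hv
      exact (congrArg Sigma.fst hl').symm
    · rintro rfl
      exact Finset.mem_map.2 ⟨l, Finset.mem_univ _, rfl⟩
  have hconn := h.2 S (by simpa [S] using Nat.lt_succ_of_le hle)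
  let u : ChainVertex a := ⟨⟨0, by omega⟩, ⟨0, ha _⟩⟩
  let v : ChainVertex a := ⟨⟨i + 1, h1⟩, ⟨0, ha _⟩⟩
  have hu : u ∈ (S : Set (ChainVertex a))ᶜ := fun hu => by
    have := congrArg Fin.val ((hS u).1 hu)
    simp only [u] at this
    omega
  have hv : v ∈ (S : Set (ChainVertex a))ᶜ := fun hv => by
    have := congrArg Fin.val ((hS v).1 hv)
    simp only [v] at this
    omega
  obtain ⟨w⟩ := hconn.preconnected ⟨u, hu⟩ ⟨v, hv⟩
  -- Along a walk that avoids the part `i`, the index of the part stays on the same side of `i`.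
  have key : ∀ x y : ((S : Set (ChainVertex a))ᶜ : Set (ChainVertex a)),
      ((chainGraph a).induce ((S : Set (ChainVertex a))ᶜ)).Walk x y →
      (x.1.1 : ℕ) < i → (y.1.1 : ℕ) < i := by
    intro x y w
    induction w with
    | nil => exact id
    | @cons x y z hxy _ ih =>
      intro hx
      refine ih ?_
      have hy : (y.1.1 : ℕ) ≠ i := fun h' => y.2 ((hS _).2 (Fin.ext h'))
      rcases hxy with h' | h' <;> simp at h' <;> omega
  have := key _ _ w h0
  simp only [v] at this
  omega

theorem lemma3p1 (d k : ℕ) (hk : 4 ≤ k) (a : Fin k → ℕ) (ha : ∀ i, 0 < a i)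
    (hconn : IsVertexConnected (d + 1) (chainGraph a))
    (hcard : Fintype.card (ChainVertex a) = (d + 2).choose 2) :
    IsGenericallyLocallyRigid d (chainGraph a) := by
  intro p hp
  have hemb : ∀ i : Fin k, 0 < (i : ℕ) → (i : ℕ) + 1 < k →
      Nonempty (Option (Fin d) ↪ Fin (a i)) := fun i h0 h1 =>
    Function.Embedding.nonempty_of_card_le (by
      simpa using hconn.lt_of_chainGraph ha h0 h1)
  let e := fun i h0 h1 => (hemb i h0 h1).some
  obtain ⟨f⟩ : Nonempty (Sym2 (Option (Fin d)) ≃ ChainVertex a) :=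
    ⟨Fintype.equivOfCardEq (by rw [hcard, Sym2.card]; simp)⟩
  refine isLocallyRigid_of_eventually ?_
  have hf : ∀ᶠ q : Realization (ChainVertex a) d in 𝓝 p,
      (Matrix.of fun s => quadCoord (q (f s))).det ≠ 0 := by
    refine ContinuousAt.eventually_ne (Continuous.continuousAt ?_) ?_
    · exact Continuous.matrix_det (continuous_matrix fun s t =>
        (continuous_quadCoord t).comp (continuous_apply _))
    · have h := hp.det_monomial_ne_zero f.toEmbedding _ quadExponent_injective
      simp only [prod_quadExponent] at h
      exact h
  have he : ∀ᶠ q : Realization (ChainVertex a) d in 𝓝 p,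
      ∀ i h0 h1, (Matrix.of fun o => homCoord (q ⟨i, e i h0 h1 o⟩)).det ≠ 0 := by
    simp only [Filter.eventually_all]
    intro i h0 h1
    refine ContinuousAt.eventually_ne (Continuous.continuousAt ?_) ?_
    · exact Continuous.matrix_det (continuous_matrix fun o b =>
        (continuous_homCoord b).comp (continuous_apply _))
    · have h := hp.det_monomial_ne_zero ((e i h0 h1).trans
        (Function.Embedding.sigmaMk (β := fun j => Fin (a j)) i)) _ homExponent_injective
      simp only [prod_homExponent] at h
      exact h
  filter_upwards [hf, he] with q hqf hqe
  exact isInfinitesimallyRigid_chainGraph hk hqe hqf
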